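/- Let $q\in\mathbb{C}$ with $q\neq 0$, $q^2\neq 1$ (roots of unity of higher order are allowed), let $n\ge 0$ be an integer, and put $\mathfrak a(z)=qz-q^{-1}z^{-1}$, $\mathfrak b(z)=z-z^{-1}$ and $$R(z)=\mathfrak a(z)\sum_{a}E_{aa}\otimes E_{aa}+\mathfrak b(z)\sum_{a\neq b}E_{aa}\otimes E_{bb}+(q-q^{-1})\sum_{a\neq b}z^{\operatorname{sgn}(b-a)}E_{ab}\otimes E_{ba}\in \operatorname{End}(\mathbb{C}^n\otimes\mathbb{C}^n).$$ Let $V$ be a complex vector space and let $T(z)=(T_{ij}(z))_{1\le i,j\le n}$ be a monodromy matrix on $V$, that is, a matrix of operators on $V$ whose matrix elements $z\mapsto f(T_{ij}(z)v)$ ($v\in V$, $f\in V^*$) are holomorphic on $\mathbb{C}\setminus\{0\}$ and which satisfies $R_{12}(z/w)\,T_1(z)\,T_2(w)=T_2(w)\,T_1(z)\,R_{12}(z/w)$ for all $z,w\in\mathbb{C}\setminus\{0\}$. A vector $\omega\ne0$ is called a highest weight vector of an operator-valued matrix $A=(A_{ij})$ with eigenvalues $(\lambda_1,\dots,\lambda_n)$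 if $A_{ij}\,\omega=0$ for $j<i$ and $A_{ii}\,\omega=\lambda_i\,\omega$ for all $i$. Let $0\le M\le n$ and $\xi\in\mathbb{C}$, and let $$K(z)=\operatorname{diag}(\underbrace{\alpha(z),\dots,\alpha(z)}_{M},\underbrace{\beta(z),\dots,\beta(z)}_{n-M}),\qquad \alpha(z)=z^2(z^2-\xi^2),\quad \beta(z)=1-\xi^2z^2 .$$ Suppose that $\omega\in V$ is a highest weight vector of $T(z)$ with eigenvalues $(P_1(z),\dots,P_n(z))$, for every $z\in\mathbb{C}\setminus\{0\}$. Then, for every $z\neq 0$ such that $T(z^{-1})$ is invertible, $P_a(z^{-1}q^{1-a})\neq 0$ for $1\le a\le n$, and $q^{2k}z^4\neq 1$ for $0\le k<n$, the vector $\omega$ is also a highest weight vector of $B(z)=T(z)\,K(z)\,T(z^{-1})^{-1}$: $B_{ij}(z)\,\omega=0$ for $j<i$, and $$B_{ii}(z)\,\omega=\Big(\Gamma_i(z)P_i(z)\widehat P_i(z^{-1})+\sum_{k=1}^{i-1}\frac{q^2-1}{q^{2k}z^4-1}\,\Gamma_k(z)P_k(z)\widehat P_k(z^{-1})\Big)\,\omega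 ,\qquad 1\le i\le n,$$ where $$\widehat P_i(z)=\Big(\prod_{a=1}^{i-1}\frac{P_a(zq^{-a})}{P_a(zq^{-a+1})}\Big)\frac{1}{P_i(zq^{-i+1})},\qquad \Gamma_k(z)=\frac{q^{k-1}\,\mathfrak b(z^2)}{\mathfrak b(q^{k-1}z^2)}\times\begin{cases}\alpha(z), & k\le M,\\ q^{-2M}\,\beta(zq^{M}), & k>M.\end{cases}$$ -/

import Mathlib

open scoped Kronecker

noncomputable section

/-- The function `𝔞(z) = q z - q⁻¹ z⁻¹`. -/
def weightA (q z : ℂ) : ℂ := q * z - q⁻¹ * z⁻¹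

/-- The function `𝔟(z) = z - z⁻¹`. -/
def weightB (z : ℂ) : ℂ := z - z⁻¹

/-- The trigonometric `R` matrix of `U_q(ĝl_n)`, an element of `End(ℂⁿ) ⊗ End(ℂⁿ)`:
`R(z) = 𝔞(z) ∑_a E_aa ⊗ E_aa + 𝔟(z) ∑_{a≠b} E_aa ⊗ E_bb
  + (q - q⁻¹) ∑_{a≠b} z^{sgn(b-a)} E_ab ⊗ E_ba`. -/
def affineR (n : ℕ) (q z : ℂ) : Matrix (Fin n × Fin n) (Fin n × Fin n) ℂ :=
  weightA q z • (∑ a : Fin n, Matrix.single a a (1 : ℂ) ⊗ₖ Matrix.single a a (1 : ℂ))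
  + weightB z • (∑ a : Fin n, ∑ b : Fin n,
      if a ≠ b then Matrix.single a a (1 : ℂ) ⊗ₖ Matrix.single b b (1 : ℂ) else 0)
  + (q - q⁻¹) • (∑ a : Fin n, ∑ b : Fin n,
      if a ≠ b then
        (if a < b then z else z⁻¹) •
          (Matrix.single a b (1 : ℂ) ⊗ₖ Matrix.single b a (1 : ℂ))
      else 0)

/-- A scalar matrix seen as a matrix of operators on `V` (each entry acts by multiplication). -/
def scalarToOp {m : Type*} (V : Type*) [AddCommGroup V] [Module ℂ V] (A : Matrix m m ℂ) :
    Matrix m m (Module.End ℂ V) :=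
  A.map (algebraMap ℂ (Module.End ℂ V))

/-- A monodromy matrix with quantum space `V`: an `n × n` matrix `T(z)` of operators on `V`, whose
matrix elements are holomorphic functions of the spectral parameter `z ∈ ℂ \ {0}`, that satisfies
the exchange relations `R₁₂(z/w) T₁(z) T₂(w) = T₂(w) T₁(z) R₁₂(z/w)`, where `T₁ = T ⊗ 1` and
`T₂ = 1 ⊗ T`. -/
structure IsMonodromyMatrix {n : ℕ} {V : Type*} [AddCommGroup V] [Module ℂ V] (q : ℂ)
    (T : ℂ → Matrix (Fin n) (Fin n) (Module.End ℂ V)) : Prop where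
  holomorphic : ∀ (i j : Fin n) (v : V) (f : Module.Dual ℂ V),
    DifferentiableOn ℂ (fun z : ℂ => f (T z i j v)) {0}ᶜ
  rtt : ∀ z w : ℂ, z ≠ 0 → w ≠ 0 →
    scalarToOp V (affineR n q (z / w))
        * (T z ⊗ₖ (1 : Matrix (Fin n) (Fin n) (Module.End ℂ V)))
        * ((1 : Matrix (Fin n) (Fin n) (Module.End ℂ V)) ⊗ₖ T w)
      = ((1 : Matrix (Fin n) (Fin n) (Module.End ℂ V)) ⊗ₖ T w)
        * (T z ⊗ₖ (1 : Matrix (Fin n) (Fin n) (Module.End ℂ V)))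
        * scalarToOp V (affineR n q (z / w))

/-- `ω` is a highest weight vector of the operator-valued matrix `A`, with eigenvalues `eig i`:
`ω ≠ 0`, the entries strictly below the diagonal annihilate `ω`, and the diagonal entries act on
`ω` as the scalars `eig i`. -/
structure IsHighestWeightVector {n : ℕ} {V : Type*} [AddCommGroup V] [Module ℂ V]
    (A : Matrix (Fin n) (Fin n) (Module.End ℂ V)) (eig : Fin n → ℂ) (ω : V) : Prop where
  ne_zero : ω ≠ 0
  lower : ∀ i j : Fin n, j < i → A i j ω = 0
  diag : ∀ i : Fin n, A i i ω = eig i • ω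

/-- `α(z; ξ) = z² (z² - ξ²)`. -/
def bdryAlpha (ξ z : ℂ) : ℂ := z ^ 2 * (z ^ 2 - ξ ^ 2)

/-- `β(z; ξ) = 1 - ξ² z²`. -/
def bdryBeta (ξ z : ℂ) : ℂ := 1 - ξ ^ 2 * z ^ 2

/-- The diagonal matrix `K(z; ξ) = diag(α, …, α, β, …, β)`, with `M` entries `α` and `n - M`
entries `β`. -/
def bdryK (n M : ℕ) (ξ z : ℂ) : Matrix (Fin n) (Fin n) ℂ :=
  Matrix.diagonal fun i : Fin n => if (i : ℕ) < M then bdryAlpha ξ z else bdryBeta ξ z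

/-- `B(z) = T(z) K(z) T(z⁻¹)⁻¹`, the inverse being taken in the ring of matrices of operators. -/
def reflectionB {n : ℕ} {V : Type*} [AddCommGroup V] [Module ℂ V]
    (T : ℂ → Matrix (Fin n) (Fin n) (Module.End ℂ V)) (K : ℂ → Matrix (Fin n) (Fin n) ℂ) (z : ℂ) :
    Matrix (Fin n) (Fin n) (Module.End ℂ V) :=
  T z * scalarToOp V (K z) * Ring.inverse (T z⁻¹)

/-- `P̂_i(z) = (∏_{a=1}^{i-1} P_a(z q^{-a}) / P_a(z q^{-a+1})) · 1 / P_i(z q^{-i+1})`.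
In this definition and the following ones the indices of `Fin n` start at `0`, so that `a : Fin n`
stands for the usual index `a + 1`. -/
def hatP {n : ℕ} (q : ℂ) (P : Fin n → ℂ → ℂ) (i : Fin n) (z : ℂ) : ℂ :=
  (∏ a ∈ Finset.univ.filter (fun a : Fin n => a < i),
      P a (z * q ^ (-((a : ℤ) + 1))) / P a (z * q ^ (-(a : ℤ))))
    * (1 / P i (z * q ^ (-(i : ℤ))))

/-- `Γ_k(z) = q^{k-1} 𝔟(z²) / 𝔟(q^{k-1} z²)` times `α(z; ξ)` if `k ≤ M` and times
`q^{-2M} β(z q^M; ξ)` if `k > M` (the usual index `k` is `k + 1` for `k : Fin n`). -/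
def bdryGamma {n : ℕ} (M : ℕ) (q ξ : ℂ) (k : Fin n) (z : ℂ) : ℂ :=
  q ^ (k : ℕ) * weightB (z ^ 2) / weightB (q ^ (k : ℕ) * z ^ 2)
    * (if (k : ℕ) < M then bdryAlpha ξ z
        else q ^ (-(2 * (M : ℤ))) * bdryBeta ξ (z * q ^ M))

end

/-! Put u = z⁻¹, S = T(u)⁻¹, s = q² and t = (z/u)² = z⁴. Each vector B_il(z) ω is a combination of
the vectors T_im(z) S_ml ω with weights α or β, so the task is to evaluate these products and their
partial sums over m.

The action of S on ω is found by a quantum Cramer rule. Since 𝔞(q⁻¹) = 0, the exchange relation at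
spectral ratio q⁻¹ makes quantum minors with parameters u, uq⁻¹, uq⁻², … q-antisymmetric in their
rows. Their Laplace expansion solves T(u) v = (const · ω) e_j for a vector of cofactors v, and
applying S gives `IsMonodromyMatrix.inverse_apply`: S is triangular on ω with diagonal P̂.

Multiplying the exchange relation by S on both sides (`IsMonodromyMatrix.exchange_inverse`) links
partial sums of T_im(z) S_mi ω (rows) with partial sums of S_jm T_mj(z) ω (columns). Triangularity
of T and S on ω turns this into first-order linear recurrences. Column total j follows from the row
totals i < j, and row total i from the column totals j ≤ i, the latter only up to the factor s^(i+1)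
t - 1. That factor may vanish for the last row; `IsMonodromyMatrix.row_total` removes it by fixing
u, varying z and using continuity.

The form of K enters at the end through α - β = z⁴ - 1, which is the coefficient t - 1 of the
recurrences. Below the diagonal every single product T_im(z) S_ml ω vanishes
(`IsMonodromyMatrix.mul_inverse_apply_of_lt`). -/

/-- The coefficient of `E_ii ⊗ E_kk` in the trigonometric `R` matrix. -/
noncomputable def affineRDiag {n : ℕ} (q x : ℂ) (i k : Fin n) : ℂ :=
  if i = k then weightA q x else weightB x

/-- The coefficient of `E_ik ⊗ E_ki`, `i ≠ k`, in the trigonometric `R` matrix. -/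
noncomputable def affineROff {n : ℕ} (q x : ℂ) (i k : Fin n) : ℂ :=
  if i = k then 0 else if i < k then (q - q⁻¹) * x else (q - q⁻¹) * x⁻¹

theorem affineR_apply {n : ℕ} (q x : ℂ) (i k j l : Fin n) :
    affineR n q x (i, k) (j, l) =
      (if i = j ∧ k = l then affineRDiag q x i k else 0)
        + (if i = l ∧ k = j then affineROff q x i k else 0) := by
  have h1 : (∑ a : Fin n, Matrix.single a a (1 : ℂ) ⊗ₖ Matrix.single a a (1 : ℂ)) (i, k) (j, l)
      = if i = j ∧ k = l ∧ i = k then 1 else 0 := by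
    rw [Matrix.sum_apply, Finset.sum_eq_single i]
    · simp only [Matrix.kroneckerMap_apply, Matrix.single_apply]
      grind
    · intro b _ hb
      simp [Matrix.kroneckerMap_apply, Matrix.single_apply, hb]
    · simp
  have h2 : (∑ a : Fin n, ∑ b : Fin n,
      if a ≠ b then Matrix.single a a (1 : ℂ) ⊗ₖ Matrix.single b b (1 : ℂ) else 0) (i, k) (j, l)
      = if i = j ∧ k = l ∧ i ≠ k then 1 else 0 := by
    rw [Matrix.sum_apply, Finset.sum_eq_single i]
    · rw [Matrix.sum_apply, Finset.sum_eq_single k]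
      · by_cases hik : i = k
        · simp [hik]
        · simp only [Matrix.kroneckerMap_apply, Matrix.single_apply, hik, ne_eq, not_false_eq_true,
            if_true]
          split_ifs <;> simp_all
      · intro b _ hb
        split_ifs <;> simp [Matrix.kroneckerMap_apply, Matrix.single_apply, hb]
      · simp
    · intro b _ hb
      rw [Matrix.sum_apply]
      refine Finset.sum_eq_zero fun c _ => ?_
      split_ifs <;> simp [Matrix.kroneckerMap_apply, Matrix.single_apply, hb]
    · simp
  have h3 : (∑ a : Fin n, ∑ b : Fin n,
      if a ≠ b then
        (if a < b then x else x⁻¹) •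
          (Matrix.single a b (1 : ℂ) ⊗ₖ Matrix.single b a (1 : ℂ))
      else 0) (i, k) (j, l)
      = if i = l ∧ k = j ∧ i ≠ k then (if i < k then x else x⁻¹) else 0 := by
    rw [Matrix.sum_apply, Finset.sum_eq_single i]
    · rw [Matrix.sum_apply, Finset.sum_eq_single k]
      · by_cases hik : i = k
        · simp [hik]
        · simp only [Matrix.smul_apply, Matrix.kroneckerMap_apply, Matrix.single_apply, hik, ne_eq,
            not_false_eq_true, if_true]
          by_cases h : i = l <;> by_cases h' : k = j <;> simp [h, h']
      · intro b _ hb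
        split_ifs <;> simp [Matrix.kroneckerMap_apply, Matrix.single_apply, hb]
      · simp
    · intro b _ hb
      rw [Matrix.sum_apply]
      refine Finset.sum_eq_zero fun c _ => ?_
      split_ifs <;> simp [Matrix.kroneckerMap_apply, Matrix.single_apply, hb]
    · simp
  rw [affineR, Matrix.add_apply, Matrix.add_apply, Matrix.smul_apply, Matrix.smul_apply,
    Matrix.smul_apply, h1, h2, h3]
  unfold affineRDiag affineROff
  by_cases hik : i = k
  · subst hik; simp
  · by_cases h1 : i = j ∧ k = l
    · have : ¬ (i = l ∧ k = j) := by rintro ⟨rfl, rfl⟩; exact hik h1.1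
      rw [if_neg (by tauto), if_pos (by tauto), if_neg (by tauto), if_pos h1, if_neg this]
      simp [hik]
    · by_cases h2 : i = l ∧ k = j
      · rw [if_neg (by tauto), if_neg (by tauto), if_pos (by tauto), if_neg h1, if_pos h2]
        simp only [hik, if_false, smul_eq_mul]
        split_ifs <;> ring
      · rw [if_neg (by tauto), if_neg (by tauto), if_neg (by tauto), if_neg h1, if_neg h2]
        simp

/-! ### Exchange relations in components, for T with T and for T with its inverse. -/

section Exchange

variable {n : ℕ} {V : Type*} [AddCommGroup V] [Module ℂ V]

theorem scalarToOp_affineR_mul_apply (q x : ℂ)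
    (A : Matrix (Fin n × Fin n) (Fin n × Fin n) (Module.End ℂ V)) (i k : Fin n)
    (c : Fin n × Fin n) :
    (scalarToOp V (affineR n q x) * A) (i, k) c
      = affineRDiag q x i k • A (i, k) c + affineROff q x i k • A (k, i) c := by
  simp only [Matrix.mul_apply, Fintype.sum_prod_type, scalarToOp, Matrix.map_apply, affineR_apply,
    map_add, add_mul, Finset.sum_add_distrib, Algebra.smul_def]
  congr 1
  · rw [Finset.sum_eq_single i, Finset.sum_eq_single k] <;> simp +contextual [eq_comm]
  · rw [Finset.sum_eq_single k, Finset.sum_eq_single i] <;> simp +contextual [eq_comm]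

theorem mul_scalarToOp_affineR_apply (q x : ℂ)
    (A : Matrix (Fin n × Fin n) (Fin n × Fin n) (Module.End ℂ V)) (j l : Fin n)
    (r : Fin n × Fin n) :
    (A * scalarToOp V (affineR n q x)) r (j, l)
      = affineRDiag q x j l • A r (j, l) + affineROff q x l j • A r (l, j) := by
  simp only [Matrix.mul_apply, Fintype.sum_prod_type, scalarToOp, Matrix.map_apply, affineR_apply,
    map_add, mul_add, Finset.sum_add_distrib, Algebra.smul_def, Algebra.commutes]
  congr 1
  · rw [Finset.sum_eq_single j, Finset.sum_eq_single l] <;> simp +contextual [eq_comm]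
  · rw [Finset.sum_eq_single l, Finset.sum_eq_single j] <;> simp +contextual [eq_comm]

theorem one_kronecker_mul_apply (A : Matrix (Fin n) (Fin n) (Module.End ℂ V))
    (B : Matrix (Fin n × Fin n) (Fin n × Fin n) (Module.End ℂ V)) (i k : Fin n)
    (c : Fin n × Fin n) :
    (((1 : Matrix (Fin n) (Fin n) (Module.End ℂ V)) ⊗ₖ A) * B) (i, k) c
      = ∑ m, A k m * B (i, m) c := by
  simp only [Matrix.mul_apply, Fintype.sum_prod_type, Matrix.kroneckerMap_apply, Matrix.one_apply]
  rw [Finset.sum_eq_single i] <;> simp +contextual [eq_comm]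

theorem kronecker_one_mul_apply (A : Matrix (Fin n) (Fin n) (Module.End ℂ V))
    (B : Matrix (Fin n × Fin n) (Fin n × Fin n) (Module.End ℂ V)) (i k : Fin n)
    (c : Fin n × Fin n) :
    ((A ⊗ₖ (1 : Matrix (Fin n) (Fin n) (Module.End ℂ V))) * B) (i, k) c
      = ∑ m, A i m * B (m, k) c := by
  simp only [Matrix.mul_apply, Fintype.sum_prod_type, Matrix.kroneckerMap_apply, Matrix.one_apply]
  refine Finset.sum_congr rfl fun m _ => ?_
  rw [Finset.sum_eq_single k] <;> simp +contextual [eq_comm]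

theorem one_kronecker_mul_one_kronecker (A B : Matrix (Fin n) (Fin n) (Module.End ℂ V)) :
    ((1 : Matrix (Fin n) (Fin n) (Module.End ℂ V)) ⊗ₖ A)
        * ((1 : Matrix (Fin n) (Fin n) (Module.End ℂ V)) ⊗ₖ B)
      = (1 : Matrix (Fin n) (Fin n) (Module.End ℂ V)) ⊗ₖ (A * B) := by
  ext1 ⟨i, k⟩ ⟨j, l⟩
  rw [one_kronecker_mul_apply]
  simp only [Matrix.kroneckerMap_apply, Matrix.one_apply, Matrix.mul_apply]
  split_ifs <;> simp

variable {q : ℂ} {T : ℂ → Matrix (Fin n) (Fin n) (Module.End ℂ V)}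

/-- The exchange relations of a monodromy matrix, entry by entry. -/
theorem IsMonodromyMatrix.rtt_apply (hT : IsMonodromyMatrix q T) {z w : ℂ} (hz : z ≠ 0)
    (hw : w ≠ 0) (i k j l : Fin n) (v : V) :
    affineRDiag q (z / w) i k • T z i j (T w k l v)
        + affineROff q (z / w) i k • T z k j (T w i l v)
      = affineRDiag q (z / w) j l • T w k l (T z i j v)
        + affineROff q (z / w) l j • T w k j (T z i l v) := by
  have h := congrFun (congrFun (hT.rtt z w hz hw) (i, k)) (j, l)
  rw [mul_assoc, scalarToOp_affineR_mul_apply, mul_scalarToOp_affineR_apply] at h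
  simp only [kronecker_one_mul_apply, one_kronecker_mul_apply] at h
  simp only [Matrix.kroneckerMap_apply, Matrix.one_apply, mul_ite, ite_mul, mul_one, mul_zero,
    one_mul, zero_mul, Finset.sum_ite_eq', Finset.mem_univ, if_true] at h
  exact LinearMap.congr_fun h v

/-- The exchange relations between a monodromy matrix and its inverse at one point. -/
theorem IsMonodromyMatrix.exchange_inverse (hT : IsMonodromyMatrix q T) {z u : ℂ} (hz : z ≠ 0)
    (hu : u ≠ 0) {S : Matrix (Fin n) (Fin n) (Module.End ℂ V)} (hTS : T u * S = 1)
    (hST : S * T u = 1) (i k j l : Fin n) (v : V) :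
    affineRDiag q (z / u) i l • S k l (T z i j v)
        + (if i = l then ∑ m, affineROff q (z / u) i m • S k m (T z m j v) else 0)
      = affineRDiag q (z / u) j k • T z i j (S k l v)
        + (if j = k then ∑ m, affineROff q (z / u) m j • T z i m (S m l v) else 0) := by
  set R := scalarToOp V (affineR n q (z / u)) with hR
  set T₁ := T z ⊗ₖ (1 : Matrix (Fin n) (Fin n) (Module.End ℂ V))
  set S₂ := (1 : Matrix (Fin n) (Fin n) (Module.End ℂ V)) ⊗ₖ S with hS₂
  have h1 : S₂ * ((1 : Matrix (Fin n) (Fin n) (Module.End ℂ V)) ⊗ₖ T u) = 1 := by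
    rw [hS₂, one_kronecker_mul_one_kronecker, hST]; simp
  have h2 : ((1 : Matrix (Fin n) (Fin n) (Module.End ℂ V)) ⊗ₖ T u) * S₂ = 1 := by
    rw [hS₂, one_kronecker_mul_one_kronecker, hTS]; simp
  -- Multiplying the exchange relation by T₂(u)⁻¹ on both sides removes T₂ from each.
  have h3 : S₂ * (R * T₁) = T₁ * (R * S₂) := by
    have h4 := congrArg (fun A => S₂ * A * S₂) (hT.rtt z u hz hu)
    simp only [mul_assoc, h2, mul_one] at h4
    rw [← mul_assoc S₂ (_ ⊗ₖ T u), h1, one_mul] at h4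
    exact h4
  have h := congrFun (congrFun h3 (i, k)) (j, l)
  rw [hS₂, one_kronecker_mul_apply, kronecker_one_mul_apply] at h
  simp only [hR, scalarToOp_affineR_mul_apply] at h
  simp only [T₁, Matrix.kroneckerMap_apply, Matrix.one_apply, mul_add, Finset.sum_add_distrib,
    mul_smul_comm, smul_ite, smul_zero, mul_ite, ite_mul, mul_one, mul_zero, one_mul, zero_mul,
    Finset.sum_ite_eq', Finset.mem_univ, if_true] at h
  have h5 := LinearMap.congr_fun h v
  have e1 : ∀ (p : Prop) [Decidable p] (f : Fin n → Module.End ℂ V),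
      (∑ m, if p then f m else 0) v = if p then ∑ m, f m v else 0 := by
    intro p _ f
    split_ifs <;> simp
  simp only [LinearMap.add_apply, e1, LinearMap.smul_apply, Module.End.mul_apply,
    eq_comm (a := k) (b := j)] at h5
  rw [h5]
  congr 1
  by_cases hjk : j = k <;> simp [hjk]

end Exchange

/-! ### Quantum minors and their row antisymmetry. -/

section QuantumMinor

variable {n : ℕ} {V : Type*} [AddCommGroup V] [Module ℂ V]

/-- The quantum minor of `T` with the given rows and columns, with spectral parameters
`u, u q⁻¹, u q⁻², …`, applied to the vector `ω`; it is defined by Laplace expansion along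
the first row. -/
noncomputable def qMinor (q : ℂ) (T : ℂ → Matrix (Fin n) (Fin n) (Module.End ℂ V)) (ω : V) :
    List (Fin n) → ℂ → Finset (Fin n) → V
  | [], _, _ => ω
  | i :: I, u, C => ∑ k ∈ C, (-q⁻¹) ^ (C.filter (· < k)).card •
      T u i k (qMinor q T ω I (u * q⁻¹) (C.erase k))

variable {q : ℂ} {T : ℂ → Matrix (Fin n) (Fin n) (Module.End ℂ V)} {ω : V}

theorem qMinor_cons (i : Fin n) (I : List (Fin n)) (u : ℂ) (C : Finset (Fin n)) :
    qMinor q T ω (i :: I) u C = ∑ k ∈ C, (-q⁻¹) ^ (C.filter (· < k)).card •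
      T u i k (qMinor q T ω I (u * q⁻¹) (C.erase k)) := rfl

/-- The column antisymmetrisation of a product of two entries vanishes for equal rows. -/
theorem IsMonodromyMatrix.antisymm_self (hT : IsMonodromyMatrix q T) (hq0 : q ≠ 0)
    (hq1 : q ^ 2 ≠ 1) {u : ℂ} (hu : u ≠ 0) (i : Fin n) {j l : Fin n} (hjl : j < l) (v : V) :
    T u i j (T (u * q⁻¹) i l v) - q⁻¹ • T u i l (T (u * q⁻¹) i j v) = 0 := by
  have hc : q - q⁻¹ ≠ 0 := by
    intro h; apply hq1; field_simp at h; linear_combination h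
  -- The spectral ratio is q⁻¹, where 𝔞 vanishes; with equal rows the whole left-hand side of the
  -- relation drops out.
  have h := hT.rtt_apply (mul_ne_zero hu (inv_ne_zero hq0)) hu i i j l v
  have hx : u * q⁻¹ / u = q⁻¹ := by field_simp
  rw [hx] at h
  simp only [affineRDiag, affineROff, if_true, hjl.ne, hjl.ne', if_false, not_lt.2 hjl.le] at h
  simp only [weightA, weightB, inv_inv, mul_inv_cancel₀ hq0, inv_mul_cancel₀ hq0, sub_self,
    zero_smul, add_zero] at h
  have h2 : ((q - q⁻¹) * q) • (T u i j (T (u * q⁻¹) i l v)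
      - q⁻¹ • T u i l (T (u * q⁻¹) i j v)) = 0 := by
    rw [h]
    match_scalars <;> field_simp
    ring
  exact (smul_eq_zero.1 h2).resolve_left (mul_ne_zero hc hq0)

/-- The column antisymmetrisation of a product of two entries is `q`-antisymmetric in the rows. -/
theorem IsMonodromyMatrix.antisymm_swap (hT : IsMonodromyMatrix q T) (hq0 : q ≠ 0)
    (hq1 : q ^ 2 ≠ 1) {u : ℂ} (hu : u ≠ 0) {i k : Fin n} (hik : i < k) {j l : Fin n}
    (hjl : j < l) (v : V) :
    T u i j (T (u * q⁻¹) k l v) - q⁻¹ • T u i l (T (u * q⁻¹) k j v)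
      + q • (T u k j (T (u * q⁻¹) i l v) - q⁻¹ • T u k l (T (u * q⁻¹) i j v)) = 0 := by
  have hc : q - q⁻¹ ≠ 0 := by
    intro h; apply hq1; field_simp at h; linear_combination h
  have h := hT.rtt_apply (mul_ne_zero hu (inv_ne_zero hq0)) hu i k j l v
  have h' := hT.rtt_apply (mul_ne_zero hu (inv_ne_zero hq0)) hu k i j l v
  have hx : u * q⁻¹ / u = q⁻¹ := by field_simp
  rw [hx] at h h'
  simp only [affineRDiag, affineROff, hik.ne, hik.ne', hik, not_lt.2 hik.le, if_true, hjl.ne,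
    hjl.ne', if_false, not_lt.2 hjl.le, weightB, inv_inv] at h h'
  have h2 : ((q - q⁻¹) * q) • (T u i j (T (u * q⁻¹) k l v)
      - q⁻¹ • T u i l (T (u * q⁻¹) k j v)
      + q • (T u k j (T (u * q⁻¹) i l v) - q⁻¹ • T u k l (T (u * q⁻¹) i j v))) = 0 := by
    -- At ratio q⁻¹ the rows (i, k) and (k, i) of R are proportional, so this combination cancels
    -- both left-hand sides.
    linear_combination (norm := (match_scalars <;> field_simp <;> ring)) (-1 : ℂ) • h' - q • h
  exact (smul_eq_zero.1 h2).resolve_left (mul_ne_zero hc hq0)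

/-- Twice the sum equals the sum of its symmetrisation in j and l, which vanishes termwise; then
divide by 2. -/
theorem sum_sum_erase_eq_zero {C : Finset (Fin n)} (f : Fin n → Fin n → V)
    (hf : ∀ j ∈ C, ∀ l ∈ C, j < l → f j l + f l j = 0) :
    ∑ j ∈ C, ∑ l ∈ C.erase j, f j l = 0 := by
  have h1 : ∑ j ∈ C, ∑ l ∈ C.erase j, f j l = ∑ j ∈ C, ∑ l ∈ C, if j = l then 0 else f j l := by
    refine Finset.sum_congr rfl fun j hj => ?_
    rw [← Finset.add_sum_erase C _ hj, if_pos rfl, zero_add]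
    exact Finset.sum_congr rfl fun l hl => by rw [if_neg (Finset.ne_of_mem_erase hl).symm]
  have h2 := h1
  rw [Finset.sum_comm] at h2
  refine (smul_eq_zero.1 ((two_smul ℂ _).trans ?_)).resolve_left two_ne_zero
  nth_rewrite 1 [h1]
  rw [h2, ← Finset.sum_add_distrib]
  refine Finset.sum_eq_zero fun j hj => ?_
  rw [← Finset.sum_add_distrib]
  refine Finset.sum_eq_zero fun l hl => ?_
  rcases lt_trichotomy j l with h | h | h
  · rw [if_neg h.ne, if_neg h.ne', hf j hj l hl h]
  · simp [h]
  · rw [if_neg h.ne, if_neg h.ne', add_comm, hf l hl j hj h]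

theorem card_filter_lt_erase_of_lt {C : Finset (Fin n)} {j l : Fin n} (hj : j ∈ C) (h : j < l) :
    (C.filter (· < l)).card = ((C.erase j).filter (· < l)).card + 1 := by
  rw [Finset.filter_erase, Finset.card_erase_add_one (Finset.mem_filter.2 ⟨hj, h⟩)]

theorem filter_lt_erase_of_le {C : Finset (Fin n)} {j l : Fin n} (h : l ≤ j) :
    (C.erase j).filter (· < l) = C.filter (· < l) := by
  ext a
  simp only [Finset.mem_filter, Finset.mem_erase]
  exact ⟨fun h' => ⟨h'.1.2, h'.2⟩, fun h' => ⟨⟨(h'.2.trans_le h).ne, h'.1⟩, h'.2⟩⟩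

theorem qMinor_cons_cons (i k : Fin n) (I : List (Fin n)) (u : ℂ) (C : Finset (Fin n)) :
    qMinor q T ω (i :: k :: I) u C = ∑ j ∈ C, ∑ l ∈ C.erase j,
      ((-q⁻¹) ^ (C.filter (· < j)).card * (-q⁻¹) ^ ((C.erase j).filter (· < l)).card) •
        T u i j (T (u * q⁻¹) k l (qMinor q T ω I (u * q⁻¹ * q⁻¹) ((C.erase j).erase l))) := by
  simp only [qMinor_cons, map_sum, map_smul, Finset.smul_sum, smul_smul]

theorem qMinor_cons_cons_self (hT : IsMonodromyMatrix q T) (hq0 : q ≠ 0) (hq1 : q ^ 2 ≠ 1)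
    {u : ℂ} (hu : u ≠ 0) (i : Fin n) (I : List (Fin n)) (C : Finset (Fin n)) :
    qMinor q T ω (i :: i :: I) u C = 0 := by
  rw [qMinor_cons_cons]
  refine sum_sum_erase_eq_zero _ fun j hj l hl hjl => ?_
  rw [card_filter_lt_erase_of_lt hj hjl, filter_lt_erase_of_le hjl.le, Finset.erase_right_comm]
  have h := hT.antisymm_self hq0 hq1 hu i hjl
    (qMinor q T ω I (u * q⁻¹ * q⁻¹) ((C.erase l).erase j))
  linear_combination (norm := module) ((-q⁻¹) ^ (C.filter (· < j)).card
    * (-q⁻¹) ^ ((C.erase j).filter (· < l)).card) • h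

theorem qMinor_cons_cons_of_lt (hT : IsMonodromyMatrix q T) (hq0 : q ≠ 0) (hq1 : q ^ 2 ≠ 1)
    {u : ℂ} (hu : u ≠ 0) {i k : Fin n} (hik : i < k) (I : List (Fin n)) (C : Finset (Fin n)) :
    qMinor q T ω (k :: i :: I) u C = (-q⁻¹) • qMinor q T ω (i :: k :: I) u C := by
  have key : qMinor q T ω (i :: k :: I) u C + q • qMinor q T ω (k :: i :: I) u C = 0 := by
    simp only [qMinor_cons_cons, Finset.smul_sum, ← Finset.sum_add_distrib]
    refine sum_sum_erase_eq_zero _ fun j hj l hl hjl => ?_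
    rw [card_filter_lt_erase_of_lt hj hjl, filter_lt_erase_of_le hjl.le, Finset.erase_right_comm]
    have h := hT.antisymm_swap hq0 hq1 hu hik hjl
      (qMinor q T ω I (u * q⁻¹ * q⁻¹) ((C.erase l).erase j))
    linear_combination (norm := module) ((-q⁻¹) ^ (C.filter (· < j)).card
      * (-q⁻¹) ^ ((C.erase j).filter (· < l)).card) • h
  rw [eq_neg_of_add_eq_zero_left key, smul_neg, smul_smul, neg_mul, inv_mul_cancel₀ hq0]
  simp

/-- The first row is moved past the smaller ones until it meets its copy. The sorted list guarantees
that each swap met on the way has the order required by `qMinor_cons_cons_of_lt`. -/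
theorem qMinor_cons_eq_zero_of_mem (hT : IsMonodromyMatrix q T) (hq0 : q ≠ 0) (hq1 : q ^ 2 ≠ 1)
    {i : Fin n} {I : List (Fin n)} (hI : I.Pairwise (· < ·)) (hi : i ∈ I) {u : ℂ} (hu : u ≠ 0)
    (C : Finset (Fin n)) : qMinor q T ω (i :: I) u C = 0 := by
  induction I generalizing u C with
  | nil => simp at hi
  | cons a I ih =>
    rw [List.pairwise_cons] at hI
    rcases List.mem_cons.1 hi with rfl | h
    · exact qMinor_cons_cons_self hT hq0 hq1 hu i I C
    · rw [qMinor_cons_cons_of_lt hT hq0 hq1 hu (hI.1 i h), qMinor_cons,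
        Finset.sum_eq_zero, smul_zero]
      intro k _
      rw [ih hI.2 h (mul_ne_zero hu (inv_ne_zero hq0)), map_zero, smul_zero]

theorem qMinor_cons_eq_concat (hT : IsMonodromyMatrix q T) (hq0 : q ≠ 0) (hq1 : q ^ 2 ≠ 1)
    {i : Fin n} {I : List (Fin n)} (hI : ∀ a ∈ I, a < i) {u : ℂ} (hu : u ≠ 0)
    (C : Finset (Fin n)) :
    qMinor q T ω (i :: I) u C = (-q⁻¹) ^ I.length • qMinor q T ω (I ++ [i]) u C := by
  induction I generalizing u C with
  | nil => simp
  | cons a I ih =>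
    rw [qMinor_cons_cons_of_lt hT hq0 hq1 hu (hI a (by simp)), List.cons_append, qMinor_cons,
      qMinor_cons, Finset.smul_sum, Finset.smul_sum]
    refine Finset.sum_congr rfl fun k _ => ?_
    rw [ih (fun b hb => hI b (by simp [hb])) (mul_ne_zero hu (inv_ne_zero hq0)), map_smul,
      List.length_cons]
    module

/-! ### Quantum minors on a highest weight vector, and Cramer's rule for the inverse. -/

section HighestWeight

variable {P : Fin n → ℂ → ℂ}

/-- The last row acts on ω first, and all columns left for it lie strictly below the diagonal. -/
theorem qMinor_concat_eq_zero
    (hω : ∀ z : ℂ, z ≠ 0 → IsHighestWeightVector (T z) (fun i => P i z) ω)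
    (hq0 : q ≠ 0) {i : Fin n} (I : List (Fin n)) {u : ℂ} (hu : u ≠ 0)
    {C : Finset (Fin n)} (hC : ∀ c ∈ C, c < i) : qMinor q T ω (I ++ [i]) u C = 0 := by
  induction I generalizing u C with
  | nil =>
    refine Finset.sum_eq_zero fun k hk => ?_
    rw [qMinor, (hω u hu).lower i k (hC k hk), smul_zero]
  | cons a I ih =>
    rw [List.cons_append, qMinor_cons]
    refine Finset.sum_eq_zero fun k _ => ?_
    rw [ih (mul_ne_zero hu (inv_ne_zero hq0)) fun c hc => hC c (Finset.mem_of_mem_erase hc),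
      map_zero, smul_zero]

/-- If column i is spent on an earlier row, the remaining minor vanishes by `qMinor_concat_eq_zero`;
so the last row uses column i. The signs do not change because i exceeds all other columns, and the
length condition fixes the spectral parameter reached by the last row. -/
theorem qMinor_concat_insert
    (hω : ∀ z : ℂ, z ≠ 0 → IsHighestWeightVector (T z) (fun i => P i z) ω)
    (hq0 : q ≠ 0) {i : Fin n} {I : List (Fin n)} {u : ℂ} (hu : u ≠ 0)
    {C : Finset (Fin n)} (hC : ∀ c ∈ C, c < i) (hcard : I.length = C.card) :
    qMinor q T ω (I ++ [i]) u (insert i C)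
      = P i (u * q ^ (-(I.length : ℤ))) • qMinor q T ω I u C := by
  induction I generalizing u C with
  | nil =>
    obtain rfl : C = ∅ := Finset.card_eq_zero.1 hcard.symm
    simp [qMinor, (hω u hu).diag i, Finset.filter_singleton]
  | cons a I ih =>
    have hi : i ∉ C := fun h => (hC i h).false
    have hu' := mul_ne_zero hu (inv_ne_zero hq0)
    rw [List.cons_append, qMinor_cons, Finset.sum_insert hi, Finset.erase_insert hi,
      qMinor_concat_eq_zero hω hq0 I hu' hC, map_zero, smul_zero, zero_add, qMinor_cons,
      Finset.smul_sum]
    refine Finset.sum_congr rfl fun k hk => ?_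
    have hki := hC k hk
    rw [Finset.erase_insert_of_ne hki.ne', ih hu' (fun c hc => hC c (Finset.mem_of_mem_erase hc))
      (by rw [Finset.card_erase_of_mem hk, ← hcard]; simp), map_smul, Finset.filter_insert,
      if_neg hki.le.not_gt, smul_comm]
    have hpow : u * q⁻¹ * q ^ (-(I.length : ℤ)) = u * q ^ (-((a :: I).length : ℤ)) := by
      rw [List.length_cons, mul_assoc, Nat.cast_succ, neg_add, zpow_add₀ hq0, zpow_neg_one,
        mul_comm q⁻¹]
    rw [hpow]

theorem toFinset_take_finRange {j : ℕ} :
    ((List.finRange n).take j).toFinset = Finset.univ.filter fun a : Fin n => (a : ℕ) < j := by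
  ext a
  simp only [List.mem_toFinset, Finset.mem_filter, Finset.mem_univ, true_and, List.mem_take_iff_getElem,
    List.getElem_finRange]
  constructor
  · rintro ⟨i, hi, rfl⟩
    exact (lt_min_iff.1 hi).1
  · intro h
    exact ⟨a, by simp [h], rfl⟩

theorem take_finRange_succ (j : Fin n) :
    (List.finRange n).take (j + 1) = (List.finRange n).take j ++ [j] := by
  rw [List.take_succ_eq_append_getElem (by simp)]
  simp

theorem filter_val_lt_succ (j : Fin n) :
    (Finset.univ.filter fun a : Fin n => (a : ℕ) < j + 1)
      = insert j (Finset.univ.filter fun a : Fin n => (a : ℕ) < j) := by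
  ext a
  simp only [Finset.mem_filter, Finset.mem_univ, true_and, Finset.mem_insert, Fin.ext_iff]
  omega

theorem card_filter_val_lt (j : Fin n) :
    (Finset.univ.filter fun a : Fin n => (a : ℕ) < j).card = j := by
  rw [← toFinset_take_finRange, List.toFinset_card_of_nodup
    ((List.nodup_finRange n).sublist (List.take_sublist _ _)), List.length_take,
    List.length_finRange, min_eq_left j.2.le]

/-- The principal quantum minors act diagonally on a highest weight vector. -/
theorem qMinor_principal (hω : ∀ z : ℂ, z ≠ 0 → IsHighestWeightVector (T z) (fun i => P i z) ω)
    (hq0 : q ≠ 0) {j : ℕ} (hj : j ≤ n) {u : ℂ} (hu : u ≠ 0) :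
    qMinor q T ω ((List.finRange n).take j) u (Finset.univ.filter fun a : Fin n => (a : ℕ) < j)
      = (∏ a ∈ Finset.univ.filter (fun a : Fin n => (a : ℕ) < j),
          P a (u * q ^ (-(a : ℤ)))) • ω := by
  induction j with
  | zero => simp [qMinor]
  | succ j ih =>
    have h1 := take_finRange_succ (⟨j, hj⟩ : Fin n)
    have h2 := filter_val_lt_succ (⟨j, hj⟩ : Fin n)
    have h3 := card_filter_val_lt (⟨j, hj⟩ : Fin n)
    simp only at h1 h2 h3
    have hlen : ((List.finRange n).take j).length = j := by simp; omega
    rw [h1, h2, qMinor_concat_insert hω hq0 hu (by simp [Fin.lt_def]) (by rw [hlen, h3]),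
      ih (by omega), Finset.prod_insert (by simp), smul_smul, hlen]

/-- Three cases: for i < j a row is repeated; for i = j the row moves to the end and leaves a
principal minor; for j < i it moves to the end, where all available columns are smaller than i. -/
theorem qMinor_cons_principal (hT : IsMonodromyMatrix q T) (hq0 : q ≠ 0) (hq1 : q ^ 2 ≠ 1)
    (hω : ∀ z : ℂ, z ≠ 0 → IsHighestWeightVector (T z) (fun i => P i z) ω)
    {u : ℂ} (hu : u ≠ 0) (i j : Fin n) :
    qMinor q T ω (i :: (List.finRange n).take j) u
        (Finset.univ.filter fun a : Fin n => (a : ℕ) < j + 1)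
      = if i = j then ((-q⁻¹) ^ (j : ℕ) * ∏ a ∈ Finset.univ.filter (fun a : Fin n => (a : ℕ) < j + 1),
          P a (u * q ^ (-(a : ℤ)))) • ω else 0 := by
  have hmem : ∀ a : Fin n, a ∈ (List.finRange n).take j ↔ (a : ℕ) < j := by
    intro a
    rw [← List.mem_toFinset, toFinset_take_finRange]
    simp
  have hlen : ((List.finRange n).take j).length = j := by simp
  rcases lt_trichotomy i j with h | rfl | h
  · rw [if_neg h.ne]
    exact qMinor_cons_eq_zero_of_mem hT hq0 hq1
      ((List.pairwise_lt_finRange n).sublist (List.take_sublist _ _)) ((hmem i).2 h) hu _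
  · rw [if_pos rfl, qMinor_cons_eq_concat hT hq0 hq1 (fun a ha => (hmem a).1 ha) hu, hlen,
      ← take_finRange_succ, qMinor_principal hω hq0 i.2 hu, smul_smul]
  · rw [if_neg h.ne', qMinor_cons_eq_concat hT hq0 hq1
      (fun a ha => Fin.lt_def.2 (((hmem a).1 ha).trans h)) hu,
      qMinor_concat_eq_zero hω hq0 _ hu, smul_zero]
    intro c hc
    have := (Finset.mem_filter.1 hc).2
    exact Fin.lt_def.2 (by have := Fin.lt_def.1 h; omega)

/-- A highest weight vector of a monodromy matrix `T` is one of `T(u)⁻¹`. -/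
theorem IsMonodromyMatrix.inverse_apply (hT : IsMonodromyMatrix q T) (hq0 : q ≠ 0)
    (hq1 : q ^ 2 ≠ 1)
    (hω : ∀ z : ℂ, z ≠ 0 → IsHighestWeightVector (T z) (fun i => P i z) ω)
    {u : ℂ} (hu : u ≠ 0) (hP : ∀ a : Fin n, P a (u * q ^ (-(a : ℤ))) ≠ 0)
    {S : Matrix (Fin n) (Fin n) (Module.End ℂ V)} (hST : S * T u = 1) (k j : Fin n) (hjk : j ≤ k) :
    S k j ω = if k = j then hatP q P j u • ω else 0 := by
  set C := Finset.univ.filter fun a : Fin n => (a : ℕ) < j + 1 with hC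
  set I := (List.finRange n).take j
  set L := ∏ a ∈ C, P a (u * q ^ (-(a : ℤ))) with hL
  have hL0 : L ≠ 0 := Finset.prod_ne_zero_iff.2 fun a _ => hP a
  have hr : (-q⁻¹) ^ (j : ℕ) ≠ 0 := pow_ne_zero _ (neg_ne_zero.2 (inv_ne_zero hq0))
  -- The vectors in brackets are the cofactors, extended by zero outside C; T(u) sends them to a
  -- multiple of ω in position j.
  have h1 : ∀ i, ∑ m, T u i m (if m ∈ C then (-q⁻¹) ^ (C.filter (· < m)).card •
      qMinor q T ω I (u * q⁻¹) (C.erase m) else 0)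
      = if i = j then ((-q⁻¹) ^ (j : ℕ) * L) • ω else 0 := by
    intro i
    rw [← qMinor_cons_principal hT hq0 hq1 hω hu i j, qMinor_cons, ← Finset.sum_subset (Finset.subset_univ C)]
    · refine Finset.sum_congr rfl fun m hm => ?_
      rw [if_pos hm, map_smul]
    · intro m _ hm
      rw [if_neg hm, map_zero]
  have h2 : ∀ v : Fin n → V, ∑ i, S k i (∑ m, T u i m (v m)) = v k := by
    intro v
    have : ∀ m, ∑ i, S k i (T u i m (v m)) = if k = m then v m else 0 := by
      intro m
      have := congrFun (congrFun hST k) m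
      rw [Matrix.mul_apply] at this
      have := LinearMap.congr_fun this (v m)
      rw [LinearMap.sum_apply] at this
      simp only [Module.End.mul_apply] at this
      rw [this, Matrix.one_apply]
      split_ifs <;> simp
    simp only [map_sum]
    rw [Finset.sum_comm]
    simp [this]
  have h3 := h2 (fun m => if m ∈ C then (-q⁻¹) ^ (C.filter (· < m)).card •
      qMinor q T ω I (u * q⁻¹) (C.erase m) else 0)
  simp only [h1] at h3
  rw [Finset.sum_eq_single j (fun b _ hb => by rw [if_neg hb, map_zero]) (by simp), if_pos rfl,
    map_smul] at h3
  split_ifs with hkj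
  · subst hkj
    have hCk : C.erase k = Finset.univ.filter fun a : Fin n => (a : ℕ) < k := by
      rw [hC, filter_val_lt_succ, Finset.erase_insert (by simp)]
    have hCk' : C.filter (· < k) = Finset.univ.filter fun a : Fin n => (a : ℕ) < k := by
      ext a
      simp only [hC, Finset.mem_filter, Finset.mem_univ, true_and, Fin.lt_def]
      omega
    have hu' := mul_ne_zero hu (inv_ne_zero hq0)
    rw [if_pos (by simp [hC]), hCk, hCk', card_filter_val_lt, qMinor_principal hω hq0 k.2.le hu',
      mul_smul] at h3
    have h4 := smul_right_injective V hr h3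
    have h5 : hatP q P k u = L⁻¹ * ∏ a ∈ Finset.univ.filter (fun a : Fin n => (a : ℕ) < k),
          P a (u * q⁻¹ * q ^ (-(a : ℤ))) := by
      rw [hL, hC, filter_val_lt_succ, Finset.prod_insert (by simp), hatP, Finset.prod_div_distrib]
      have : (∏ a ∈ Finset.univ.filter (fun a : Fin n => a < k), P a (u * q ^ (-((a : ℤ) + 1))))
          = ∏ a ∈ Finset.univ.filter (fun a : Fin n => (a : ℕ) < k),
          P a (u * q⁻¹ * q ^ (-(a : ℤ))) := by
        refine Finset.prod_congr rfl fun a _ => ?_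
        rw [mul_assoc, neg_add, zpow_add₀ hq0, zpow_neg_one, mul_comm q⁻¹]
      rw [this]
      simp only [Fin.lt_def]
      field_simp
    rw [h5, mul_smul, ← h4, smul_smul, inv_mul_cancel₀ hL0, one_smul]
  -- For k > j the index k lies outside C, so the k-th cofactor is zero.
  · rw [if_neg] at h3
    · exact (smul_eq_zero.1 h3).resolve_left (mul_ne_zero hr hL0)
    · have : (j : ℕ) < k := lt_of_le_of_ne hjk fun h => hkj (Fin.ext h.symm)
      simp [hC]; omega

end HighestWeight

end QuantumMinor

/-! ### Partial sums and the off-diagonal part of R. -/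

section PrefixSum

variable {n : ℕ} {V : Type*} [AddCommGroup V]

/-- The sum of the first `k` terms of a finite family. -/
def prefixSum (X : Fin n → V) (k : ℕ) : V :=
  ∑ m ∈ Finset.univ.filter (fun m : Fin n => (m : ℕ) < k), X m

@[simp]
theorem prefixSum_zero (X : Fin n → V) : prefixSum X 0 = 0 := by
  simp [prefixSum]

theorem prefixSum_succ (X : Fin n → V) (j : Fin n) :
    prefixSum X (j + 1) = prefixSum X j + X j := by
  rw [prefixSum, filter_val_lt_succ, Finset.sum_insert (by simp), add_comm]
  rfl

theorem prefixSum_eq_total {X : Fin n → V} {k : ℕ} (hX : ∀ m : Fin n, k ≤ m → X m = 0) :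
    prefixSum X k = ∑ m, X m := by
  refine Finset.sum_subset (Finset.subset_univ _) fun m _ hm => hX m ?_
  simpa using hm

theorem prefixSum_ite_smul [Module ℂ V] (X : Fin n → V) (a b : ℂ) (M : ℕ) {k : ℕ} (hk : k ≤ n) :
    prefixSum (fun m => (if (m : ℕ) < M then a else b) • X m) k
      = a • prefixSum X (min k M) + b • (prefixSum X k - prefixSum X (min k M)) := by
  induction k with
  | zero => simp
  | succ k ih =>
    have h1 := prefixSum_succ (fun m => (if (m : ℕ) < M then a else b) • X m) ⟨k, hk⟩
    have h2 := prefixSum_succ X ⟨k, hk⟩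
    simp only at h1 h2
    rw [h1, ih (by omega), h2]
    split_ifs with h
    · rw [min_eq_left h.le, min_eq_left (Nat.succ_le_of_lt h), h2]
      module
    · rw [min_eq_right (not_lt.1 h), min_eq_right ((not_lt.1 h).trans k.le_succ)]
      module

theorem sum_filter_gt (X : Fin n → V) (j : Fin n) :
    ∑ m ∈ Finset.univ.filter (fun m : Fin n => j < m), X m = ∑ m, X m - prefixSum X (j + 1) := by
  rw [eq_sub_iff_add_eq', prefixSum,
    ← Finset.sum_filter_add_sum_filter_not Finset.univ (fun m : Fin n => (m : ℕ) < j + 1)]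
  congr 1
  refine Finset.sum_congr ?_ fun _ _ => rfl
  ext m
  simp only [Finset.mem_filter, Finset.mem_univ, true_and, Fin.lt_def]
  omega

variable [Module ℂ V] {q x : ℂ}

theorem sum_affineROff_left (X : Fin n → V) (i : Fin n) :
    ∑ m, affineROff q x i m • X m = ((q - q⁻¹) * x⁻¹) • prefixSum X i
      + ((q - q⁻¹) * x) • (∑ m, X m - prefixSum X (i + 1)) := by
  rw [← sum_filter_gt, prefixSum, Finset.smul_sum, Finset.smul_sum, Finset.sum_filter,
    Finset.sum_filter, ← Finset.sum_add_distrib]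
  refine Finset.sum_congr rfl fun m _ => ?_
  rw [affineROff]
  simp only [← Fin.lt_def]
  rcases lt_trichotomy i m with h | h | h
  · rw [if_neg h.ne, if_pos h, if_pos h, if_neg (not_lt.2 h.le), zero_add]
  · simp [h]
  · rw [if_neg h.ne', if_neg (not_lt.2 h.le), if_neg (not_lt.2 h.le), if_pos h, add_zero]

theorem sum_affineROff_right (X : Fin n → V) (j : Fin n) :
    ∑ m, affineROff q x m j • X m = ((q - q⁻¹) * x) • prefixSum X j
      + ((q - q⁻¹) * x⁻¹) • (∑ m, X m - prefixSum X (j + 1)) := by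
  rw [← sum_filter_gt, prefixSum, Finset.smul_sum, Finset.smul_sum, Finset.sum_filter,
    Finset.sum_filter, ← Finset.sum_add_distrib]
  refine Finset.sum_congr rfl fun m _ => ?_
  rw [affineROff]
  simp only [← Fin.lt_def]
  rcases lt_trichotomy j m with h | h | h
  · rw [if_neg h.ne', if_neg (not_lt.2 h.le), if_pos h, if_neg (not_lt.2 h.le), zero_add]
  · simp [h]
  · rw [if_neg h.ne, if_pos h, if_pos h, if_neg (not_lt.2 h.le), add_zero]

/-- The off-diagonal weight is proportional to x on one side of j and to x⁻¹ on the other, so the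
sum splits into prefix sums and a total; the prefactor q x clears denominators. -/
theorem weightA_add_sum_affineROff_right (hq0 : q ≠ 0) (hx : x ≠ 0) (X : Fin n → V) (j : Fin n) :
    (q * x) • (weightA q x • X j + ∑ m, affineROff q x m j • X m)
      = (x ^ 2 - 1) • (q ^ 2 • prefixSum X (j + 1) - prefixSum X j)
        + (q ^ 2 - 1) • ∑ m, X m := by
  rw [sum_affineROff_right, prefixSum_succ, weightA]
  match_scalars <;> field_simp <;> ring

theorem weightA_add_sum_affineROff_left (hq0 : q ≠ 0) (hx : x ≠ 0) (X : Fin n → V) (i : Fin n) :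
    (q * x) • (weightA q x • X i + ∑ m, affineROff q x i m • X m)
      = (x ^ 2 - 1) • (prefixSum X (i + 1) - q ^ 2 • prefixSum X i)
        + ((q ^ 2 - 1) * x ^ 2) • ∑ m, X m := by
  rw [sum_affineROff_left, prefixSum_succ, weightA]
  match_scalars <;> field_simp <;> ring

end PrefixSum

/-! ### Solving the recurrences for row and column sums, as pure linear algebra with s = q² and t =
(z/u)². -/

section Recurrence

variable {n : ℕ} {V : Type*} [AddCommGroup V] [Module ℂ V]

/-- The coefficient `sᵏ (t - 1) / (sᵏ t - 1)`. -/
noncomputable def gammaCoeff (s t : ℂ) (k : ℕ) : ℂ := s ^ k * (t - 1) / (s ^ k * t - 1)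

/-- The family `(s - 1) / (sᵏ⁺¹ t - 1) · g_k p_k`, with `g_k = sᵏ (t - 1) / (sᵏ t - 1)`. -/
noncomputable def tailTerm (s t : ℂ) (p : Fin n → V) (k : Fin n) : V :=
  ((s - 1) / (s ^ ((k : ℕ) + 1) * t - 1) * gammaCoeff s t k) • p k

theorem mul_prefixSum_tailTerm_succ {s t : ℂ} (p : Fin n → V) {k : Fin n}
    (hk : s ^ ((k : ℕ) + 1) * t ≠ 1) :
    (s ^ ((k : ℕ) + 1) * t - 1) • prefixSum (tailTerm s t p) (k + 1)
      = (s ^ ((k : ℕ) + 1) * t - 1) • prefixSum (tailTerm s t p) k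
        + ((s - 1) * gammaCoeff s t k) • p k := by
  have := sub_ne_zero.2 hk
  rw [prefixSum_succ, smul_add, tailTerm, smul_smul]
  congr 2
  field_simp

variable {s t : ℂ} {p : Fin n → V} {F G : Fin n → ℕ → V} {Q Y : Fin n → V}

/-- Here G j i is the i-th partial sum of column j, Y its total, Q the row totals and p the diagonal
terms. The total appears in its own recurrence and is isolated at the end using Y j = G j j + p j.
-/
theorem column_total_eq (hs : s ≠ 0)
    (hG0 : ∀ j, G j 0 = 0) (hGj : ∀ j : Fin n, Y j = G j j + p j)
    {j : Fin n} (hj : ∀ k : ℕ, k ≤ j → s ^ k * t ≠ 1)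
    (hrec : ∀ i < j, (t - 1) • (G j (i + 1) - s • G j i) = ((s - 1) * t) • (Q i - Y j))
    (hQ : ∀ i < j, Q i = gammaCoeff s t i • p i + prefixSum (tailTerm s t p) i) :
    Y j = (s⁻¹ ^ (j : ℕ) * gammaCoeff s t j) • p j + t • prefixSum (tailTerm s t p) j := by
  have key : ∀ i : ℕ, i ≤ j → (t - 1) • G j i + ((s ^ i - 1) * t) • Y j
      = (t * (s ^ i * t - 1)) • prefixSum (tailTerm s t p) i := by
    intro i hi
    induction i with
    | zero => simp [hG0]
    | succ i ih =>
      have hin : i < n := by omega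
      have h1 := hrec ⟨i, hin⟩ hi
      have h2 := hQ ⟨i, hin⟩ hi
      have h3 := mul_prefixSum_tailTerm_succ (s := s) (t := t) p (k := ⟨i, hin⟩) (hj (i + 1) hi)
      have h4 := ih (by omega)
      simp only at h1 h2 h3
      rw [h2] at h1
      linear_combination (norm := module) h1 + s • h4 - t • h3
  have h := key j le_rfl
  have h1 := sub_ne_zero.2 (hj j le_rfl)
  have h2 : (s ^ (j : ℕ) * t - 1) • Y j
      = (t - 1) • p j + (t * (s ^ (j : ℕ) * t - 1)) • prefixSum (tailTerm s t p) j := by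
    linear_combination (norm := module) h + (t - 1) • hGj j
  have h3 : (s ^ (j : ℕ) * t - 1) * (s⁻¹ ^ (j : ℕ) * gammaCoeff s t j) = t - 1 := by
    rw [gammaCoeff, inv_pow]
    field_simp
  apply smul_right_injective V h1
  linear_combination (norm := module) h2 - h3 • p j

/-- As for columns, adding (sʲ - 1) Q i absorbs the unknown row total. The resulting formula is also
what is needed at j = M, where K changes from α to β. -/
theorem row_prefix_eq (hs : s ≠ 0) {i : Fin n} (hF0 : F i 0 = 0)
    (hi : ∀ k : ℕ, k ≤ i → s ^ k * t ≠ 1)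
    (hrec : ∀ j < i, (t - 1) • (s • F i (j + 1) - F i j) = (s - 1) • (Y j - Q i))
    (hY : ∀ j < i, Y j = (s⁻¹ ^ (j : ℕ) * gammaCoeff s t j) • p j
      + t • prefixSum (tailTerm s t p) j) {j : ℕ} (hj : j ≤ i) :
    ((t - 1) * s ^ j) • F i j + (s ^ j - 1) • Q i
      = (s ^ j * t - 1) • prefixSum (tailTerm s t p) j := by
  induction j with
  | zero => simp [hF0]
  | succ j ih =>
    have hin : j < n := by omega
    have h1 := hrec ⟨j, hin⟩ hj
    have h2 := hY ⟨j, hin⟩ hj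
    have h3 := mul_prefixSum_tailTerm_succ (s := s) (t := t) p (k := ⟨j, hin⟩) (hi (j + 1) hj)
    have h4 := ih (by omega)
    simp only at h1 h2 h3
    rw [h2] at h1
    have h5 : s ^ j * s⁻¹ ^ j = 1 := by rw [← mul_pow, mul_inv_cancel₀ hs, one_pow]
    have h6 : ((s - 1) * (s ^ j * s⁻¹ ^ j) * gammaCoeff s t j) • p ⟨j, hin⟩
        = ((s - 1) * gammaCoeff s t j) • p ⟨j, hin⟩ := by rw [h5, mul_one]
    linear_combination (norm := module) s ^ j • h1 + h4 - h3 + h6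

/-- The prefix formula at j = i is closed by the diagonal relation `hlast`. The factor is kept,
because nonvanishing is assumed only for exponents up to i. -/
theorem mul_row_total_eq (hs : s ≠ 0) {i : Fin n} (hF0 : F i 0 = 0)
    (hi : ∀ k : ℕ, k ≤ i → s ^ k * t ≠ 1)
    (hrec : ∀ j < i, (t - 1) • (s • F i (j + 1) - F i j) = (s - 1) • (Y j - Q i))
    (hlast : (t - 1) • (s • Q i - F i i) = (s - 1) • (Y i - Q i) + (s * (t - 1)) • p i)
    (hY : ∀ j ≤ i, Y j = (s⁻¹ ^ (j : ℕ) * gammaCoeff s t j) • p j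
      + t • prefixSum (tailTerm s t p) j) :
    (s ^ ((i : ℕ) + 1) * t - 1) • (Q i - (gammaCoeff s t i • p i
      + prefixSum (tailTerm s t p) i)) = 0 := by
  have h1 := row_prefix_eq hs hF0 hi hrec (fun j hj => hY j hj.le) le_rfl
  have h2 := hY i le_rfl
  rw [h2] at hlast
  have h5 : s ^ (i : ℕ) * s⁻¹ ^ (i : ℕ) = 1 := by rw [← mul_pow, mul_inv_cancel₀ hs, one_pow]
  have h6 : (s ^ (i : ℕ) * t - 1) * gammaCoeff s t i = s ^ (i : ℕ) * (t - 1) := by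
    rw [gammaCoeff, mul_div_cancel₀ _ (sub_ne_zero.2 (hi i le_rfl))]
  linear_combination (norm := module) s ^ (i : ℕ) • hlast + h1
    + ((s - 1) * gammaCoeff s t i) • h5 • p i - s • h6 • p i

end Recurrence

/-! ### Row and column sums of T(z) and T(u)⁻¹ on the highest weight vector. -/

section RowTotal

open Filter
open scoped Topology

variable {n : ℕ} {V : Type*} [AddCommGroup V] [Module ℂ V] {q : ℂ}
  {T : ℂ → Matrix (Fin n) (Fin n) (Module.End ℂ V)}
  {S : Matrix (Fin n) (Fin n) (Module.End ℂ V)}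

/-- This is the component k = j, l = i of the exchange relation with the inverse, where the extra
sums on both sides survive. -/
theorem IsMonodromyMatrix.exchange_prefixSum (hT : IsMonodromyMatrix q T) (hq0 : q ≠ 0) {z u : ℂ}
    (hz : z ≠ 0) (hu : u ≠ 0) (hTS : T u * S = 1) (hST : S * T u = 1) (v : V) (i j : Fin n) :
    ((z / u) ^ 2 - 1) • (q ^ 2 • prefixSum (fun m => T z i m (S m i v)) (j + 1)
          - prefixSum (fun m => T z i m (S m i v)) j)
        + (q ^ 2 - 1) • ∑ m, T z i m (S m i v)
      = ((z / u) ^ 2 - 1) • (prefixSum (fun m => S j m (T z m j v)) (i + 1)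
          - q ^ 2 • prefixSum (fun m => S j m (T z m j v)) i)
        + ((q ^ 2 - 1) * (z / u) ^ 2) • ∑ m, S j m (T z m j v) := by
  have h := hT.exchange_inverse hz hu hTS hST i j j i v
  simp only [affineRDiag, if_true] at h
  have hx := div_ne_zero hz hu
  rw [← weightA_add_sum_affineROff_right hq0 hx (fun m => T z i m (S m i v)),
    ← weightA_add_sum_affineROff_left hq0 hx (fun m => S j m (T z m j v)), h]

/-- For l ≠ i the extra sum survives only on the side of T S; the other side is a single term, which
kills ω when j < i. -/
theorem IsMonodromyMatrix.exchange_prefixSum_of_ne (hT : IsMonodromyMatrix q T) (hq0 : q ≠ 0)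
    {z u : ℂ} (hz : z ≠ 0) (hu : u ≠ 0) (hTS : T u * S = 1) (hST : S * T u = 1) (v : V)
    {i l : Fin n} (hil : i ≠ l) (j : Fin n) :
    ((z / u) ^ 2 - 1) • (q ^ 2 • prefixSum (fun m => T z i m (S m l v)) (j + 1)
          - prefixSum (fun m => T z i m (S m l v)) j)
        + (q ^ 2 - 1) • ∑ m, T z i m (S m l v)
      = (q * (z / u) * weightB (z / u)) • S j l (T z i j v) := by
  have h := hT.exchange_inverse hz hu hTS hST i j j l v
  simp only [affineRDiag, if_true, hil, if_false, add_zero] at h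
  rw [← weightA_add_sum_affineROff_right hq0 (div_ne_zero hz hu) (fun m => T z i m (S m l v)),
    ← h, smul_smul]

variable {ω : V} {h : Fin n → ℂ} {P : Fin n → ℂ → ℂ}

theorem continuousAt_gammaCoeff {s : ℂ} {t : ℂ → ℂ} {z : ℂ} (ht : ContinuousAt t z) {k : ℕ}
    (hk : s ^ k * t z ≠ 1) : ContinuousAt (fun w => gammaCoeff s (t w) k) z := by
  unfold gammaCoeff
  exact ContinuousAt.div (by fun_prop) (by fun_prop) (sub_ne_zero.2 hk)

/-- The column sums `∑ S_jm(u) T_mj(z) ω`, given the row sums `∑ T_im(z) S_mi(u) ω` for `i < j`. -/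
theorem IsMonodromyMatrix.column_total (hT : IsMonodromyMatrix q T) (hq0 : q ≠ 0) {z u : ℂ}
    (hz : z ≠ 0) (hu : u ≠ 0) (hTS : T u * S = 1) (hST : S * T u = 1)
    (hω : IsHighestWeightVector (T z) (fun i => P i z) ω)
    (hS : ∀ k j, j ≤ k → S k j ω = if k = j then h j • ω else 0)
    {j : Fin n} (hj : ∀ k : ℕ, k ≤ j → (q ^ 2) ^ k * (z / u) ^ 2 ≠ 1)
    (hQ : ∀ i < j, ∑ m, T z i m (S m i ω)
      = gammaCoeff (q ^ 2) ((z / u) ^ 2) i • T z i i (S i i ω)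
        + prefixSum (tailTerm (q ^ 2) ((z / u) ^ 2) fun k => T z k k (S k k ω)) i) :
    ∑ m, S j m (T z m j ω)
      = ((q ^ 2)⁻¹ ^ (j : ℕ) * gammaCoeff (q ^ 2) ((z / u) ^ 2) j) • T z j j (S j j ω)
        + (z / u) ^ 2 •
          prefixSum (tailTerm (q ^ 2) ((z / u) ^ 2) fun k => T z k k (S k k ω)) j := by
  have hG : ∀ j : Fin n, prefixSum (fun m => S j m (T z m j ω)) (j + 1)
      = ∑ m, S j m (T z m j ω) := fun j =>
    prefixSum_eq_total fun m hm => by rw [hω.lower m j (Fin.lt_def.2 hm), map_zero]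
  have hF : ∀ i j : Fin n, i < j → prefixSum (fun m => T z i m (S m i ω)) j
      = ∑ m, T z i m (S m i ω) := fun i j hij =>
    prefixSum_eq_total fun m hm => by
      have : i < m := Fin.lt_def.2 ((Fin.lt_def.1 hij).trans_le hm)
      rw [hS m i this.le, if_neg this.ne', map_zero]
  refine column_total_eq (s := q ^ 2) (t := (z / u) ^ 2) (p := fun k => T z k k (S k k ω))
    (G := fun j => prefixSum fun m => S j m (T z m j ω))
    (Y := fun j => ∑ m, S j m (T z m j ω)) (Q := fun i => ∑ m, T z i m (S m i ω))
    (pow_ne_zero 2 hq0) (fun _ => prefixSum_zero _) (fun k => ?_) hj (fun i hi => ?_) hQ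
  · rw [← hG k, prefixSum_succ, hω.diag k, hS k k le_rfl, if_pos rfl, map_smul, map_smul,
      hω.diag k, hS k k le_rfl, if_pos rfl, smul_comm]
  · have h1 := hT.exchange_prefixSum hq0 hz hu hTS hST ω i j
    rw [hF i j hi, prefixSum_eq_total (k := (j : ℕ) + 1) fun m hm => by
      have : i < m := Fin.lt_def.2 ((Fin.lt_def.1 hi).trans hm)
      rw [hS m i this.le, if_neg this.ne', map_zero]] at h1
    linear_combination (norm := module) -h1

/-- The recursion for the partial row sums `∑ T_im(z) S_mi(u) ω`. -/
theorem IsMonodromyMatrix.row_prefix_rec (hT : IsMonodromyMatrix q T) (hq0 : q ≠ 0) {z u : ℂ}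
    (hz : z ≠ 0) (hu : u ≠ 0) (hTS : T u * S = 1) (hST : S * T u = 1)
    (hω : IsHighestWeightVector (T z) (fun i => P i z) ω) {i j : Fin n} (hj : j < i) :
    ((z / u) ^ 2 - 1) • (q ^ 2 • prefixSum (fun m => T z i m (S m i ω)) (j + 1)
          - prefixSum (fun m => T z i m (S m i ω)) j)
      = (q ^ 2 - 1) • (∑ m, S j m (T z m j ω) - ∑ m, T z i m (S m i ω)) := by
  have h1 := hT.exchange_prefixSum hq0 hz hu hTS hST ω i j
  have hG : ∀ k : ℕ, (j : ℕ) + 1 ≤ k → prefixSum (fun m => S j m (T z m j ω)) k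
      = ∑ m, S j m (T z m j ω) := fun k hk =>
    prefixSum_eq_total fun m hm => by
      rw [hω.lower m j (Fin.lt_def.2 (by omega)), map_zero]
  have := Fin.lt_def.1 hj
  rw [hG i (by omega), hG (i + 1) (by omega)] at h1
  linear_combination (norm := module) h1

/-- On the diagonal, both prefix sums up to i + 1 are already totals, and the column sum up to i
misses only S_ii T_ii ω. This equals T_ii S_ii ω, since ω is an eigenvector of both factors. -/
theorem IsMonodromyMatrix.row_prefix_last (hT : IsMonodromyMatrix q T) (hq0 : q ≠ 0) {z u : ℂ}
    (hz : z ≠ 0) (hu : u ≠ 0) (hTS : T u * S = 1) (hST : S * T u = 1)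
    (hω : IsHighestWeightVector (T z) (fun i => P i z) ω)
    (hS : ∀ k j, j ≤ k → S k j ω = if k = j then h j • ω else 0) (i : Fin n) :
    ((z / u) ^ 2 - 1) • (q ^ 2 • ∑ m, T z i m (S m i ω)
          - prefixSum (fun m => T z i m (S m i ω)) i)
      = (q ^ 2 - 1) • (∑ m, S i m (T z m i ω) - ∑ m, T z i m (S m i ω))
        + (q ^ 2 * ((z / u) ^ 2 - 1)) • T z i i (S i i ω) := by
  have h1 := hT.exchange_prefixSum hq0 hz hu hTS hST ω i i
  have hG : prefixSum (fun m => S i m (T z m i ω)) (i + 1)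
      = ∑ m, S i m (T z m i ω) :=
    prefixSum_eq_total fun m hm => by rw [hω.lower m i (Fin.lt_def.2 hm), map_zero]
  have hF : prefixSum (fun m => T z i m (S m i ω)) (i + 1)
      = ∑ m, T z i m (S m i ω) :=
    prefixSum_eq_total fun m hm => by
      have : i < m := Fin.lt_def.2 hm
      rw [hS m i this.le, if_neg this.ne', map_zero]
  have hG' := hG
  rw [prefixSum_succ] at hG'
  have hp : S i i (T z i i ω) = T z i i (S i i ω) := by
    rw [hω.diag i, hS i i le_rfl, if_pos rfl, map_smul, map_smul, hω.diag i, hS i i le_rfl,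
      if_pos rfl, smul_comm]
  rw [hp] at hG'
  rw [hG, hF] at h1
  linear_combination (norm := module) h1 - (((z / u) ^ 2 - 1) * q ^ 2) • hG'

/-- The row sums `∑ T_im(z) S_mi(u) ω`. -/
theorem IsMonodromyMatrix.row_total (hT : IsMonodromyMatrix q T) (hq0 : q ≠ 0) {u : ℂ}
    (hu : u ≠ 0) (hTS : T u * S = 1) (hST : S * T u = 1)
    (hω : ∀ z : ℂ, z ≠ 0 → IsHighestWeightVector (T z) (fun i => P i z) ω)
    (hS : ∀ k j, j ≤ k → S k j ω = if k = j then h j • ω else 0)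
    (i : Fin n) {z : ℂ} (hz : z ≠ 0) (hi : ∀ k : ℕ, k ≤ i → (q ^ 2) ^ k * (z / u) ^ 2 ≠ 1) :
    ∑ m, T z i m (S m i ω)
      = gammaCoeff (q ^ 2) ((z / u) ^ 2) i • T z i i (S i i ω)
        + prefixSum (tailTerm (q ^ 2) ((z / u) ^ 2) fun k => T z k k (S k k ω)) i := by
  induction i using WellFoundedLT.induction generalizing z with
  | ind i ih =>
  have hq2 : q ^ 2 ≠ 0 := pow_ne_zero 2 hq0
  -- The discrepancy as a function of the first spectral parameter alone; u, and hence S, stays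
  -- fixed.
  set D : ℂ → V := fun w => ∑ m, T w i m (S m i ω)
      - (gammaCoeff (q ^ 2) ((w / u) ^ 2) i • T w i i (S i i ω)
        + prefixSum (tailTerm (q ^ 2) ((w / u) ^ 2) fun k => T w k k (S k k ω)) i) with hD
  have key : ∀ w : ℂ, w ≠ 0 → (∀ k : ℕ, k ≤ i → (q ^ 2) ^ k * (w / u) ^ 2 ≠ 1) →
      ((q ^ 2) ^ ((i : ℕ) + 1) * (w / u) ^ 2 - 1) • D w = 0 := by
    intro w hw hk
    refine mul_row_total_eq (s := q ^ 2) (t := (w / u) ^ 2) (p := fun k => T w k k (S k k ω))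
      (F := fun i => prefixSum fun m => T w i m (S m i ω))
      (Y := fun j => ∑ m, S j m (T w m j ω)) (Q := fun i => ∑ m, T w i m (S m i ω))
      hq2 (prefixSum_zero _) hk (fun j hj => hT.row_prefix_rec hq0 hw hu hTS hST (hω w hw) hj)
      (hT.row_prefix_last hq0 hw hu hTS hST (hω w hw) hS i) fun j hj => ?_
    have hj' := Fin.le_def.1 hj
    exact hT.column_total hq0 hw hu hTS hST (hω w hw) hS (fun k hkj => hk k (by omega))
      fun a ha => ih a (ha.trans_le hj) hw fun k hka => hk k (by have := Fin.lt_def.1 ha; omega)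
  suffices D z = 0 from sub_eq_zero.1 this
  -- V carries no topology, so continuity is used on matrix elements.
  refine (Module.forall_dual_apply_eq_zero_iff ℂ _).1 fun f => ?_
  have hc : ∀ a b v, ContinuousAt (fun w => f (T w a b v)) z := fun a b v =>
    ((hT.holomorphic a b v f).continuousOn).continuousAt (isOpen_compl_singleton.mem_nhds hz)
  have ht : ContinuousAt (fun w : ℂ => (w / u) ^ 2) z := by fun_prop
  have hcont : ContinuousAt (fun w => f (D w)) z := by
    simp only [hD, map_sub, map_sum, map_add, map_smul, prefixSum, tailTerm, smul_eq_mul]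
    refine ContinuousAt.sub (tendsto_finsetSum _ fun m _ => hc _ _ _)
      (((continuousAt_gammaCoeff ht (hi i le_rfl)).mul (hc _ _ _)).add
        (tendsto_finsetSum _ fun k hk => ?_))
    have hki := (Finset.mem_filter.1 hk).2
    refine ContinuousAt.mul (ContinuousAt.mul (ContinuousAt.div (by fun_prop) (by fun_prop)
      (sub_ne_zero.2 (hi _ hki))) (continuousAt_gammaCoeff ht (hi _ hki.le))) (hc _ _ _)
  have hev : ∀ᶠ w in 𝓝[≠] z, f (D w) = 0 := by
    have h1 : ∀ᶠ w in 𝓝[≠] z, w ≠ 0 := eventually_nhdsWithin_of_eventually_nhds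
      (isOpen_ne.mem_nhds hz)
    have h2 : ∀ᶠ w in 𝓝[≠] z, ∀ k ∈ Finset.range (i + 1), (q ^ 2) ^ k * (w / u) ^ 2 ≠ 1 := by
      refine eventually_nhdsWithin_of_eventually_nhds ((Finset.eventually_all _).2 fun k hk => ?_)
      exact (ht.const_mul _).eventually_ne (hi k (by simpa [Nat.lt_succ_iff] using hk))
    -- If the factor vanishes at z, its only zeros are z and -z, as it depends on w through w²; both
    -- are avoided near z.
    have h3 : ∀ᶠ w in 𝓝[≠] z, w ≠ -z := eventually_nhdsWithin_of_eventually_nhds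
      (isOpen_ne.mem_nhds (self_ne_neg.2 hz))
    by_cases hne : (q ^ 2) ^ ((i : ℕ) + 1) * (z / u) ^ 2 = 1
    · filter_upwards [h1, h2, h3, self_mem_nhdsWithin] with w hw1 hw2 hw3 hw4
      have h5 : (q ^ 2) ^ ((i : ℕ) + 1) * (w / u) ^ 2 - 1 ≠ 0 := by
        intro h6
        rw [← hne, ← mul_sub, div_pow, div_pow, ← sub_div] at h6
        have h7 : w ^ 2 - z ^ 2 = 0 := by
          rcases mul_eq_zero.1 h6 with h | h
          · exact absurd h (pow_ne_zero _ hq2)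
          · exact (div_eq_zero_iff.1 h).resolve_right (pow_ne_zero 2 hu)
        rcases sq_eq_sq_iff_eq_or_eq_neg.1 (sub_eq_zero.1 h7) with h | h
        · exact hw4 h
        · exact hw3 h
      rw [(smul_eq_zero.1 (key w hw1 fun k hk => hw2 k (by simpa [Nat.lt_succ_iff] using hk))
        ).resolve_left h5, map_zero]
    · have h4 : ∀ᶠ w in 𝓝[≠] z, (q ^ 2) ^ ((i : ℕ) + 1) * (w / u) ^ 2 ≠ 1 :=
        eventually_nhdsWithin_of_eventually_nhds ((ht.const_mul _).eventually_ne hne)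
      filter_upwards [h1, h2, h4] with w hw1 hw2 hw4
      rw [(smul_eq_zero.1 (key w hw1 fun k hk => hw2 k (by simpa [Nat.lt_succ_iff] using hk))
        ).resolve_left (sub_ne_zero.2 hw4), map_zero]
  exact tendsto_nhds_unique (hcont.tendsto.mono_left nhdsWithin_le_nhds)
    (tendsto_const_nhds.congr' (hev.mono fun _ h => h.symm))

/-- The partial row sums `∑_{m < j} T_im(z) S_mi(u) ω` for `j ≤ i`. -/
theorem IsMonodromyMatrix.row_prefix (hT : IsMonodromyMatrix q T) (hq0 : q ≠ 0) {u : ℂ}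
    (hu : u ≠ 0) (hTS : T u * S = 1) (hST : S * T u = 1)
    (hω : ∀ z : ℂ, z ≠ 0 → IsHighestWeightVector (T z) (fun i => P i z) ω)
    (hS : ∀ k j, j ≤ k → S k j ω = if k = j then h j • ω else 0)
    (i : Fin n) {z : ℂ} (hz : z ≠ 0) (hi : ∀ k : ℕ, k ≤ i → (q ^ 2) ^ k * (z / u) ^ 2 ≠ 1)
    {j : ℕ} (hj : j ≤ i) :
    (((z / u) ^ 2 - 1) * (q ^ 2) ^ j) • prefixSum (fun m => T z i m (S m i ω)) j
        + ((q ^ 2) ^ j - 1) • ∑ m, T z i m (S m i ω)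
      = ((q ^ 2) ^ j * (z / u) ^ 2 - 1) •
        prefixSum (tailTerm (q ^ 2) ((z / u) ^ 2) fun k => T z k k (S k k ω)) j := by
  refine row_prefix_eq (s := q ^ 2) (t := (z / u) ^ 2) (p := fun k => T z k k (S k k ω))
    (F := fun i => prefixSum fun m => T z i m (S m i ω))
    (Y := fun j => ∑ m, S j m (T z m j ω)) (Q := fun i => ∑ m, T z i m (S m i ω))
    (pow_ne_zero 2 hq0) (prefixSum_zero _) hi
    (fun j hj => hT.row_prefix_rec hq0 hz hu hTS hST (hω z hz) hj) (fun k hk => ?_) hj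
  have hk' := Fin.lt_def.1 hk
  exact hT.column_total hq0 hz hu hTS hST (hω z hz) hS (fun m hm => hi m (by omega))
    fun a ha => hT.row_total hq0 hu hTS hST hω hS a hz
      fun m hm => hi m (by have := Fin.lt_def.1 ha; omega)

/-- All the products `T_im(z) S_ml(u)` with `l < i` annihilate the highest weight vector. -/
theorem IsMonodromyMatrix.mul_inverse_apply_of_lt (hT : IsMonodromyMatrix q T) (hq0 : q ≠ 0)
    {z u : ℂ} (hz : z ≠ 0) (hu : u ≠ 0) (hTS : T u * S = 1) (hST : S * T u = 1)
    (hω : IsHighestWeightVector (T z) (fun i => P i z) ω)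
    (hS : ∀ k j, j ≤ k → S k j ω = if k = j then h j • ω else 0)
    (hi : ∀ k : ℕ, k < n → (q ^ 2) ^ k * (z / u) ^ 2 ≠ 1) {i l : Fin n} (hl : l < i) (m : Fin n) :
    T z i m (S m l ω) = 0 := by
  rcases lt_or_ge l m with hm | hm
  · rw [hS m l hm.le, if_neg hm.ne', map_zero]
  set X : Fin n → V := fun m => T z i m (S m l ω) with hX
  have hlv := Fin.lt_def.1 hl
  -- The columns used are at most l < i, so T_ij ω = 0 makes the recurrence homogeneous.
  have hF : ∀ j : ℕ, j ≤ l + 1 →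
      (((z / u) ^ 2 - 1) * (q ^ 2) ^ j) • prefixSum X j + ((q ^ 2) ^ j - 1) • ∑ m, X m = 0 := by
    intro j hj
    induction j with
    | zero => simp
    | succ j ih =>
      have hjn : j < n := by omega
      have h1 := hT.exchange_prefixSum_of_ne hq0 hz hu hTS hST ω hl.ne' ⟨j, hjn⟩
      rw [hω.lower i ⟨j, hjn⟩ (Fin.lt_def.2 (by simp only; omega)), map_zero, smul_zero] at h1
      have h2 := ih (by omega)
      simp only [← hX] at h1
      linear_combination (norm := module) (q ^ 2) ^ j • h1 + h2
  have htot : prefixSum X (l + 1) = ∑ m, X m := prefixSum_eq_total fun m hm => by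
    have : l < m := Fin.lt_def.2 hm
    rw [hX]
    simp only
    rw [hS m l this.le, if_neg this.ne', map_zero]
  have hzero : ∑ m, X m = 0 := by
    have h1 := hF (l + 1) le_rfl
    rw [htot] at h1
    have h2 : ((q ^ 2) ^ ((l : ℕ) + 1) * (z / u) ^ 2 - 1) • ∑ m, X m = 0 := by
      linear_combination (norm := module) h1
    -- Since l + 1 ≤ i < n, the exponent is covered by the assumption and no limit is needed.
    exact (smul_eq_zero.1 h2).resolve_left (sub_ne_zero.2 (hi _ (by omega)))
  have hpre : ∀ j : ℕ, j ≤ l + 1 → prefixSum X j = 0 := by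
    intro j hj
    have h1 := hF j hj
    rw [hzero, smul_zero, add_zero] at h1
    refine (smul_eq_zero.1 h1).resolve_left (mul_ne_zero ?_ (pow_ne_zero _ (pow_ne_zero 2 hq0)))
    have := hi 0 (by omega)
    rw [pow_zero, one_mul] at this
    exact sub_ne_zero.2 this
  have hmv := Fin.le_def.1 hm
  have h3 := prefixSum_succ X m
  rw [hpre _ (by omega), hpre _ (by omega), zero_add] at h3
  exact h3.symm

end RowTotal

/-! ### Assembly: the entries of B(z) on the highest weight vector. -/

theorem qpow_mul_weightB_div {q z : ℂ} (hq0 : q ≠ 0) (hz : z ≠ 0) (k : ℕ) :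
    q ^ k * weightB (z ^ 2) / weightB (q ^ k * z ^ 2) = gammaCoeff (q ^ 2) (z ^ 4) k := by
  have h1 : weightB (z ^ 2) = (z ^ 4 - 1) / z ^ 2 := by
    rw [weightB]; field_simp
  have h2 : weightB (q ^ k * z ^ 2) = ((q ^ 2) ^ k * z ^ 4 - 1) / (q ^ k * z ^ 2) := by
    rw [weightB, ← pow_mul, mul_comm 2 k, pow_mul]; field_simp
  have h3 : (q ^ 2) ^ k = q ^ k * q ^ k := by rw [← pow_mul, mul_comm 2 k, pow_mul, sq]
  have hqk : q ^ k ≠ 0 := pow_ne_zero k hq0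
  rw [h1, h2, gammaCoeff, div_div_eq_mul_div, h3]
  congr 1
  field_simp

theorem reflectionB_apply {n : ℕ} {V : Type*} [AddCommGroup V] [Module ℂ V]
    (T : ℂ → Matrix (Fin n) (Fin n) (Module.End ℂ V)) (M : ℕ) (ξ z : ℂ) (i l : Fin n) (v : V) :
    reflectionB T (bdryK n M ξ) z i l v
      = ∑ m : Fin n, (if (m : ℕ) < M then bdryAlpha ξ z else bdryBeta ξ z) •
          T z i m (Ring.inverse (T z⁻¹) m l v) := by
  have h : ∀ m, (T z * scalarToOp V (bdryK n M ξ z)) i m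
      = (if (m : ℕ) < M then bdryAlpha ξ z else bdryBeta ξ z) • T z i m := by
    intro m
    rw [Matrix.mul_apply, Finset.sum_eq_single m]
    · simp only [scalarToOp, Matrix.map_apply, bdryK, Matrix.diagonal_apply_eq]
      rw [Algebra.smul_def, Algebra.commutes]
    · intro b _ hb
      simp [scalarToOp, bdryK, Matrix.diagonal_apply_ne _ hb]
    · simp
  rw [reflectionB, Matrix.mul_apply, LinearMap.sum_apply]
  simp only [h, Module.End.mul_apply, LinearMap.smul_apply]

theorem theorem1 {n : ℕ} {V : Type*} [AddCommGroup V] [Module ℂ V]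
    (q : ℂ) (hq0 : q ≠ 0) (hq1 : q ^ 2 ≠ 1)
    (M : ℕ) (hM : M ≤ n) (ξ : ℂ)
    (T : ℂ → Matrix (Fin n) (Fin n) (Module.End ℂ V)) (hT : IsMonodromyMatrix q T)
    (P : Fin n → ℂ → ℂ) (ω : V)
    (hω : ∀ z : ℂ, z ≠ 0 → IsHighestWeightVector (T z) (fun i => P i z) ω)
    -- a point `z` at which `B(z)` and the claimed eigenvalues are defined
    (z : ℂ) (hz : z ≠ 0)
    (hinv : IsUnit (T z⁻¹))
    (hP : ∀ a : Fin n, P a (z⁻¹ * q ^ (-(a : ℤ))) ≠ 0)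
    (hpole : ∀ k : ℕ, k < n → q ^ (2 * k) * z ^ 4 ≠ 1) :
    IsHighestWeightVector (reflectionB T (bdryK n M ξ) z)
      (fun i => bdryGamma M q ξ i z * P i z * hatP q P i z⁻¹
        + ∑ k ∈ Finset.univ.filter (fun k : Fin n => k < i),
            (q ^ 2 - 1) / (q ^ (2 * ((k : ℕ) + 1)) * z ^ 4 - 1)
              * (bdryGamma M q ξ k z * P k z * hatP q P k z⁻¹))
      ω := by
  have hu : z⁻¹ ≠ 0 := inv_ne_zero hz
  have hTS := Ring.mul_inverse_cancel _ hinv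
  have hST := Ring.inverse_mul_cancel _ hinv
  have hB := fun i l => reflectionB_apply T M ξ z i l ω
  set S := Ring.inverse (T z⁻¹)
  have hS := hT.inverse_apply hq0 hq1 hω hu hP hST
  have hx : (z / z⁻¹) ^ 2 = z ^ 4 := by rw [div_inv_eq_mul]; ring
  have hgen : ∀ k : ℕ, k < n → (q ^ 2) ^ k * (z / z⁻¹) ^ 2 ≠ 1 := fun k hk => by
    rw [hx, ← pow_mul]; exact hpole k hk
  refine ⟨(hω z hz).ne_zero, fun i l hl => ?_, fun i => ?_⟩
  · rw [hB]
    refine Finset.sum_eq_zero fun m _ => ?_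
    rw [hT.mul_inverse_apply_of_lt hq0 hz hu hTS hST (hω z hz) hS hgen hl, smul_zero]
  set p : Fin n → V := fun k => T z k k (S k k ω) with hp
  have hpk : ∀ k, p k = (P k z * hatP q P k z⁻¹) • ω := fun k => by
    rw [hp]
    simp only
    rw [hS k k le_rfl, if_pos rfl, map_smul, (hω z hz).diag k, smul_smul, mul_comm]
  set γ : ℂ := q ^ (-(2 * (M : ℤ))) * bdryBeta ξ (z * q ^ M) with hγ
  set τ : Fin n → V := tailTerm (q ^ 2) (z ^ 4) p with hτ
  have hgi : ∀ k : ℕ, k ≤ i → (q ^ 2) ^ k * (z / z⁻¹) ^ 2 ≠ 1 := fun k hk => hgen k (by omega)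
  have hQ := hT.row_total hq0 hu hTS hST hω hS i hz hgi
  have hF := fun j => hT.row_prefix hq0 hu hTS hST hω hS i hz hgi (j := j)
  rw [hx, ← hp, ← hτ] at hQ
  simp only [hx, ← hp, ← hτ] at hF
  have hL : reflectionB T (bdryK n M ξ) z i i ω
      = bdryAlpha ξ z • prefixSum (fun m => T z i m (S m i ω)) M
        + bdryBeta ξ z • (∑ m, T z i m (S m i ω)
          - prefixSum (fun m => T z i m (S m i ω)) M) := by
    rw [hB, ← prefixSum_eq_total (k := n) (fun m hm => absurd m.2 (not_lt.2 hm)),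
      prefixSum_ite_smul _ _ _ _ le_rfl, min_eq_right hM,
      prefixSum_eq_total (X := fun m => T z i m (S m i ω)) (k := n)
        (fun m hm => absurd m.2 (not_lt.2 hm))]
  have hR : (bdryGamma M q ξ i z * P i z * hatP q P i z⁻¹
        + ∑ k ∈ Finset.univ.filter (fun k : Fin n => k < i),
            (q ^ 2 - 1) / (q ^ (2 * ((k : ℕ) + 1)) * z ^ 4 - 1)
              * (bdryGamma M q ξ k z * P k z * hatP q P k z⁻¹)) • ω
      = ((if (i : ℕ) < M then bdryAlpha ξ z else γ) * gammaCoeff (q ^ 2) (z ^ 4) i) • p i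
        + (bdryAlpha ξ z • prefixSum τ (min i M)
          + γ • (prefixSum τ i - prefixSum τ (min i M))) := by
    rw [← prefixSum_ite_smul τ _ _ _ i.2.le, add_smul, Finset.sum_smul, prefixSum]
    congr 1
    · rw [bdryGamma, qpow_mul_weightB_div hq0 hz, hpk, smul_smul]
      congr 1
      ring
    · refine Finset.sum_congr rfl fun k _ => ?_
      rw [bdryGamma, qpow_mul_weightB_div hq0 hz, hτ, tailTerm, hpk, smul_smul, smul_smul,
        ← pow_mul]
      congr 1
      ring
  rw [hL, hR]
  split_ifs with hiM
  -- For i < M the terms with m ≥ M vanish, so only α contributes.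
  · rw [min_eq_left hiM.le, prefixSum_eq_total fun m hm => by
      have : i < m := Fin.lt_def.2 (by omega)
      rw [hS m i this.le, if_neg this.ne', map_zero], hQ]
    module
  · have hMi := not_lt.1 hiM
    rw [min_eq_right hMi]
    have h1 := hF M hMi
    have hs : (q ^ 2) ^ M ≠ 0 := pow_ne_zero _ (pow_ne_zero 2 hq0)
    -- The constant γ is designed so that s^M γ = s^M β - (s^M - 1), where the last term comes from
    -- eliminating the partial sum up to M by `h1`; this uses α - β = z⁴ - 1.
    have h2 : (q ^ 2) ^ M * γ = 1 - (q ^ 2) ^ M * ξ ^ 2 * z ^ 2 := by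
      have : q ^ (-(2 * (M : ℤ))) = ((q ^ 2) ^ M)⁻¹ := by
        rw [zpow_neg, ← pow_mul]; norm_cast
      rw [hγ, this, mul_inv_cancel_left₀ hs, bdryBeta]
      ring
    apply smul_right_injective V hs
    simp only [bdryAlpha, bdryBeta]
    rw [hQ] at h1 ⊢
    linear_combination (norm := module) h1 - h2 • (gammaCoeff (q ^ 2) (z ^ 4) i • p i
      + (prefixSum τ i - prefixSum τ M))
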